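/- Let $D$ be an integral domain with quotient field $K$. For a nonzero fractional ideal $I$ of $D$ put $I^{-1}=\{x\in K: xI\subseteq D\}$, $I_v=(I^{-1})^{-1}$, and $I_t=\bigcup\{J_v : J\subseteq I \text{ a nonzero finitely generated fractional ideal}\}$. A nonzero fractional ideal $I$ is a *$t$-ideal* if $I_t=I$, is *$t$-invertible* if $(II^{-1})_t=D$, and is a *$v$-ideal of finite type* if $I=J_v$ for some nonzero finitely generated fractional ideal $J$. A *maximal $t$-ideal* is an integral $t$-ideal that is maximal among the proper integral $t$-ideals of $D$; a *rigid ideal* is an integral $v$-ideal of finite type contained in one and only one maximal $t$-ideal. $D$ is *completely integrally closed* if every $x\in K$ for which there is $0\neq r\in D$ with $rx^n\in D$ for all $n\ge 1$ belongs to $D$. $D$ is a *locally finite intersection* of a family of valuation domains with quotient field $K$ if $D$ is the intersection of the family (the empty intersection being $K$) and each nonzero element of $D$ is a nonunit in only finitely many members of it. $D$ is a *ring of Krull type* if it is a locally finite intersection of essential valuation domains, i.e. of valuation domains of the form $D_P$ with $P$ a prime ideal of $D$. **Proposition 3.1.** Let $D$ be a ring of Krull type. The following statements are equivalent. (1) $D$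 is completely integrally closed. (2) $\bigcap_{n=1}^{\infty}(I^{n})_{v}=(0)$ for every proper integral $t$-invertible $t$-ideal $I\subsetneq D$. (3) $\bigcap_{n=1}^{\infty}(J^{n})_{v}=(0)$ for every rigid ideal $J$ of $D$. (4) Every maximal $t$-ideal of $D$ has height one. (5) $D$ is a locally finite intersection of rank-one valuation domains with quotient field $K$ (rank one meaning Krull dimension one). -/

import Mathlib

open scoped nonZeroDivisors

namespace KrullType

variable {D : Type*} [CommRing D] [IsDomain D] {K : Type*} [Field K] [Algebra D K]
  [IsFractionRing D K]

/-- The `v`-operation `I ↦ I_v = (I⁻¹)⁻¹`, where `I⁻¹ = (D :_K I) = {x ∈ K | x I ⊆ D}`.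
It is only meaningful for nonzero `I`; on the zero ideal it takes the value `0`. -/
noncomputable def vClosure (I : FractionalIdeal D⁰ K) : FractionalIdeal D⁰ K := (I⁻¹)⁻¹

theorem inv_ne_zero_of_ne_zero {I : FractionalIdeal D⁰ K} (hI : I ≠ 0) : I⁻¹ ≠ 0 := by
  intro h
  have h1 := FractionalIdeal.bot_lt_mul_inv (I := I) hI
  rw [h, mul_zero] at h1
  exact lt_irrefl _ h1

theorem vClosure_mono {I J : FractionalIdeal D⁰ K} (h : I ≤ J) : vClosure I ≤ vClosure J := by
  unfold vClosure
  by_cases hI : I = 0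
  · rw [hI, FractionalIdeal.inv_zero', FractionalIdeal.inv_zero']
    exact FractionalIdeal.zero_le _
  · have hJ : J ≠ 0 := fun hJ => hI (by simpa [hJ] using h)
    exact FractionalIdeal.inv_anti_mono (inv_ne_zero_of_ne_zero hJ) (inv_ne_zero_of_ne_zero hI)
      (FractionalIdeal.inv_anti_mono hI hJ h)

/-- The `t`-operation: `I_t` is the union of the `J_v`, where `J` runs over the finitely generated
fractional ideals contained in `I`. (The index `J = 0` contributes only the element `0`.) -/
noncomputable def tClosure (I : FractionalIdeal D⁰ K) : FractionalIdeal D⁰ K :=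
  ⟨{ carrier := {x | ∃ J : FractionalIdeal D⁰ K,
        (J : Submodule D K).FG ∧ J ≤ I ∧ x ∈ vClosure J}
     zero_mem' := ⟨0, by simpa using Submodule.fg_bot, by simp,
        (vClosure (0 : FractionalIdeal D⁰ K) : Submodule D K).zero_mem⟩
     add_mem' := by
       rintro x y ⟨J₁, hf₁, hl₁, hx⟩ ⟨J₂, hf₂, hl₂, hy⟩
       refine ⟨J₁ ⊔ J₂, ?_, sup_le hl₁ hl₂, ?_⟩
       · rw [FractionalIdeal.coe_sup]
         exact hf₁.sup hf₂
       · exact (vClosure (J₁ ⊔ J₂) : Submodule D K).add_mem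
           (vClosure_mono le_sup_left hx) (vClosure_mono le_sup_right hy)
     smul_mem' := by
       rintro c x ⟨J, hf, hl, hx⟩
       exact ⟨J, hf, hl, (vClosure J : Submodule D K).smul_mem c hx⟩ },
   by
     obtain ⟨a, ha, h⟩ := (vClosure I).isFractional
     refine ⟨a, ha, ?_⟩
     rintro x ⟨J, _, hl, hx⟩
     exact h x (vClosure_mono hl hx)⟩

theorem mem_tClosure {I : FractionalIdeal D⁰ K} {x : K} :
    x ∈ tClosure I ↔ ∃ J : FractionalIdeal D⁰ K,
      (J : Submodule D K).FG ∧ J ≤ I ∧ x ∈ vClosure J :=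
  Iff.rfl

/-- A nonzero fractional ideal `I` is a `v`-ideal of finite type if `I = J_v` for some nonzero
finitely generated fractional ideal `J`. -/
def IsFiniteTypeVIdeal (I : FractionalIdeal D⁰ K) : Prop :=
  ∃ J : FractionalIdeal D⁰ K, J ≠ 0 ∧ (J : Submodule D K).FG ∧ I = vClosure J

/-- A `t`-ideal is a nonzero fractional ideal with `I_t = I`. -/
def IsTIdeal (I : FractionalIdeal D⁰ K) : Prop := I ≠ 0 ∧ tClosure I = I

/-- A nonzero fractional ideal `I` is `t`-invertible if `(I I⁻¹)_t = D`. -/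
def IsTInvertible (I : FractionalIdeal D⁰ K) : Prop := I ≠ 0 ∧ tClosure (I * I⁻¹) = 1

variable (K)

/-- A proper integral `t`-ideal of `D`. -/
def IsProperTIdeal (I : Ideal D) : Prop :=
  I ≠ ⊤ ∧ IsTIdeal (I : FractionalIdeal D⁰ K)

/-- A maximal `t`-ideal: maximal (for inclusion) among the proper integral `t`-ideals of `D`. -/
def IsMaximalTIdeal (M : Ideal D) : Prop := Maximal (IsProperTIdeal K) M

/-- A rigid ideal: an integral `v`-ideal of finite type that is contained in one and only one
maximal `t`-ideal. -/
def IsRigidIdeal (J : Ideal D) : Prop :=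
  IsFiniteTypeVIdeal (J : FractionalIdeal D⁰ K) ∧ ∃! M : Ideal D, IsMaximalTIdeal K M ∧ J ≤ M

/-- `⋂_{n ≥ 1} (I^n)_v = (0)`. -/
def HasZeroVPowerIntersection (I : Ideal D) : Prop :=
  ⋂ n : ℕ, ⋂ _ : 1 ≤ n, (vClosure ((I : FractionalIdeal D⁰ K) ^ n) : Set K) = {0}

variable (D)

/-- `D` is completely integrally closed: every element of the quotient field `K` that is almost
integral over `D` lies in `D`. -/
def IsCompletelyIntegrallyClosed : Prop :=
  ∀ x : K, IsAlmostIntegral D x → x ∈ (algebraMap D K).range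

variable {K}

/-- `D` is the intersection of the valuation rings `V ∈ S` of its quotient field `K` (the empty
intersection being `K`), and every nonzero element of `D` is a nonunit in only finitely many
of them. -/
def IsLocallyFiniteIntersection (S : Set (ValuationSubring K)) : Prop :=
  (∀ x : K, x ∈ (algebraMap D K).range ↔ ∀ V ∈ S, x ∈ V) ∧
    ∀ d : D, d ≠ 0 → {V ∈ S | V.valuation (algebraMap D K d) < 1}.Finite

/-- A valuation ring `V` of `K` is essential for `D` if `V = D_P` (as subrings of `K`) for some
prime ideal `P` of `D`. -/
def IsEssentialValuationRing (V : ValuationSubring K) : Prop :=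
  ∃ P : Ideal D, P.IsPrime ∧
    ∀ x : K, x ∈ V ↔ ∃ a s : D, s ∉ P ∧ x = algebraMap D K a / algebraMap D K s

variable (K)

/-- `D` is a ring of Krull type: a locally finite intersection of essential valuation domains. -/
def IsRingOfKrullType : Prop :=
  ∃ S : Set (ValuationSubring K),
    (∀ V ∈ S, IsEssentialValuationRing D V) ∧ IsLocallyFiniteIntersection D S

/-- `D` is a locally finite intersection of rank-one valuation domains (of its quotient field).
The rank of a valuation domain is its Krull dimension. -/
def IsLocallyFiniteIntersectionOfRankOne : Prop :=
  ∃ S : Set (ValuationSubring K),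
    (∀ V ∈ S, ringKrullDim V = 1) ∧ IsLocallyFiniteIntersection D S

end KrullType

set_option linter.unusedSectionVars false

namespace KrullType

/-! ### The v- and t-operations. -/

section Closure

variable {D : Type*} [CommRing D] [IsDomain D] {K : Type*} [Field K] [Algebra D K]
  [IsFractionRing D K]

/-! The conditions are proved in a cycle. Call P a center if D_P belongs to the given family.
Nonzero centers are t-ideals, because finitely generated ideals become principal in D_P; conversely,
local finiteness puts every proper t-ideal inside a center. So the maximal t-ideals are the maximal
nonzero centers, and D is the intersection of the valuation rings D_M. (1) ⇒ (2): if 0 ≠ x lies in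
every (I^n)_v, each y in I⁻¹ has xy^n in D, so I⁻¹ ⊆ D, and t-invertibility forces I = D. (2) ⇒ (3):
v-ideals of finite type are t-invertible. (3) ⇒ (4): given a prime 0 ≠ Q < M, take a in M outside Q
and a rigid J ≤ M containing a. In D_M each a^n divides all of Q, and J is trivial at the other
maximal t-ideals, so Q lies in every (J^n)_v. (4) ⇒ (5): the rings D_M have dimension one. (5) ⇒
(1): rank-one valuation rings are completely integrally closed. -/

theorem mem_vClosure {I : FractionalIdeal D⁰ K} (hI : I ≠ 0) {x : K} :
    x ∈ vClosure I ↔ ∀ y : K, (∀ i ∈ I, y * i ∈ (1 : FractionalIdeal D⁰ K)) →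
      x * y ∈ (1 : FractionalIdeal D⁰ K) := by
  unfold vClosure
  rw [FractionalIdeal.mem_inv_iff (inv_ne_zero_of_ne_zero hI)]
  simp only [FractionalIdeal.mem_inv_iff hI]

theorem le_vClosure (I : FractionalIdeal D⁰ K) : I ≤ vClosure I := by
  rcases eq_or_ne I 0 with rfl | hI
  · exact FractionalIdeal.zero_le _
  · intro x hx
    refine (mem_vClosure hI).2 fun y hy => ?_
    rw [mul_comm]
    exact hy x hx

theorem vClosure_ne_zero {I : FractionalIdeal D⁰ K} (hI : I ≠ 0) : vClosure I ≠ 0 :=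
  inv_ne_zero_of_ne_zero (inv_ne_zero_of_ne_zero hI)

theorem vClosure_vClosure_le {I : FractionalIdeal D⁰ K} (hI : I ≠ 0) :
    vClosure (vClosure I) ≤ vClosure I := by
  intro x hx
  refine (mem_vClosure hI).2 fun y hy => (mem_vClosure (vClosure_ne_zero hI)).1 hx y ?_
  intro i hi
  rw [mul_comm]
  exact (mem_vClosure hI).1 hi y hy

theorem vClosure_le_one {I : FractionalIdeal D⁰ K} (hI : I ≤ 1) : vClosure I ≤ 1 := by
  refine (vClosure_mono hI).trans fun x hx => ?_
  have := (mem_vClosure (one_ne_zero (α := FractionalIdeal D⁰ K))).1 hx 1 (by simp)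
  rwa [mul_one] at this

theorem tClosure_le_vClosure (I : FractionalIdeal D⁰ K) : tClosure I ≤ vClosure I := by
  rintro x ⟨J, -, hJ, hx⟩
  exact vClosure_mono hJ hx

theorem tClosure_mono {I J : FractionalIdeal D⁰ K} (h : I ≤ J) : tClosure I ≤ tClosure J := by
  rintro x ⟨A, hf, hA, hx⟩
  exact ⟨A, hf, hA.trans h, hx⟩

theorem le_tClosure (I : FractionalIdeal D⁰ K) : I ≤ tClosure I := by
  intro x hx
  refine ⟨FractionalIdeal.spanSingleton D⁰ x, ?_, ?_, le_vClosure _ ?_⟩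
  · rw [FractionalIdeal.coe_spanSingleton]
    exact Submodule.fg_span_singleton x
  · simpa using hx
  · exact FractionalIdeal.mem_spanSingleton_self D⁰ x

theorem IsFiniteTypeVIdeal.isTIdeal {I : FractionalIdeal D⁰ K} (h : IsFiniteTypeVIdeal I) :
    IsTIdeal I := by
  obtain ⟨J, hJ, -, rfl⟩ := h
  exact ⟨vClosure_ne_zero hJ,
    ((tClosure_le_vClosure _).trans (vClosure_vClosure_le hJ)).antisymm (le_tClosure _)⟩

theorem IsTIdeal.vClosure_le {I J : FractionalIdeal D⁰ K} (hI : IsTIdeal I)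
    (hf : (J : Submodule D K).FG) (hJ : J ≤ I) : vClosure J ≤ I := by
  intro x hx
  rw [← hI.2]
  exact ⟨J, hf, hJ, hx⟩

theorem algebraMap_mem_one (d : D) : algebraMap D K d ∈ (1 : FractionalIdeal D⁰ K) :=
  (FractionalIdeal.mem_one_iff D⁰).2 ⟨d, rfl⟩

theorem algebraMap_mem_coeIdeal {I : Ideal D} {d : D} :
    algebraMap D K d ∈ (I : FractionalIdeal D⁰ K) ↔ d ∈ I := by
  rw [FractionalIdeal.mem_coeIdeal]
  refine ⟨?_, fun h => ⟨d, h, rfl⟩⟩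
  rintro ⟨e, he, h⟩
  rwa [← IsFractionRing.injective D K h]

end Closure

/-! ### Essential valuation rings and their centers. -/

section Essential

variable {D : Type*} [CommRing D] [IsDomain D] {K : Type*} [Field K] [Algebra D K]
  [IsFractionRing D K]

/-- The valuation ring `V` equals `D_P`, with `P` a prime ideal of `D`. -/
def IsLocalizationAt (V : ValuationSubring K) (P : Ideal D) : Prop :=
  P.IsPrime ∧ ∀ x : K, x ∈ V ↔ ∃ a s : D, s ∉ P ∧ x = algebraMap D K a / algebraMap D K s

theorem algebraMap_ne_zero {d : D} (hd : d ≠ 0) : algebraMap D K d ≠ 0 :=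
  (map_ne_zero_iff _ (IsFractionRing.injective D K)).2 hd

namespace IsLocalizationAt

variable {V W : ValuationSubring K} {P Q : Ideal D}

theorem ne_zero_of_notMem {s : D} (hs : s ∉ P) : algebraMap D K s ≠ 0 :=
  algebraMap_ne_zero fun h => hs (h ▸ P.zero_mem)

theorem algebraMap_mem (h : IsLocalizationAt V P) (d : D) : algebraMap D K d ∈ V :=
  (h.2 _).2 ⟨d, 1, h.1.one_notMem, by simp⟩

theorem inv_mem_iff (h : IsLocalizationAt V P) {d : D} (hd : d ≠ 0) :
    (algebraMap D K d)⁻¹ ∈ V ↔ d ∉ P := by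
  refine ⟨fun hV hP => ?_, fun hP => (h.2 _).2 ⟨1, d, hP, by simp⟩⟩
  obtain ⟨a, s, hs, e⟩ := (h.2 _).1 hV
  refine hs ?_
  have : s = d * a := by
    apply IsFractionRing.injective D K
    have h1 := algebraMap_ne_zero (K := K) hd
    have h2 : algebraMap D K s ≠ 0 := ne_zero_of_notMem hs
    rw [map_mul]
    field_simp at e
    exact e
  rw [this]
  exact P.mul_mem_right _ hP

theorem valuation_lt_one_iff (h : IsLocalizationAt V P) {d : D} :
    V.valuation (algebraMap D K d) < 1 ↔ d ∈ P := by
  rcases eq_or_ne d 0 with rfl | hd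
  · simp
  · have h1 := algebraMap_ne_zero (K := K) hd
    rw [← not_iff_not, ← h.inv_mem_iff hd, ← V.valuation_le_one_iff, map_inv₀, not_lt,
      inv_le_one₀ (zero_lt_iff.2 ((Valuation.ne_zero_iff _).2 h1))]

theorem le_of_le (hV : IsLocalizationAt V P) (hW : IsLocalizationAt W Q) (h : P ≤ Q) : W ≤ V := by
  intro x hx
  obtain ⟨a, s, hs, e⟩ := (hW.2 x).1 hx
  exact (hV.2 x).2 ⟨a, s, fun hP => hs (h hP), e⟩

/-- A finitely generated fractional ideal becomes principal in an essential valuation ring. -/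
theorem exists_div_mem_inv (h : IsLocalizationAt V P) {J : FractionalIdeal D⁰ K} (hJ : J ≠ 0)
    (hf : (J : Submodule D K).FG) :
    ∃ x ∈ J, x ≠ 0 ∧ ∃ s : D, s ∉ P ∧
      ∀ j ∈ J, algebraMap D K s / x * j ∈ (1 : FractionalIdeal D⁰ K) := by
  obtain ⟨t, ht⟩ := hf
  have htJ : ∀ j ∈ t, j ∈ J := fun j hj => by
    rw [← FractionalIdeal.mem_coe, ← ht]
    exact Submodule.subset_span hj
  have hne : ∃ j ∈ t, j ≠ 0 := by
    by_contra! h0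
    apply hJ
    rw [← FractionalIdeal.coeToSubmodule_eq_bot, ← ht, Submodule.span_eq_bot]
    exact h0
  obtain ⟨j₀, hj₀, hj₀0⟩ := hne
  -- A generator of largest value generates J over V; the product of the denominators of all j / x
  -- is the required s.
  obtain ⟨x, hx, hmax⟩ := t.exists_max_image (fun j => V.valuation j) ⟨j₀, hj₀⟩
  have hx0 : x ≠ 0 := by
    rintro rfl
    have := hmax j₀ hj₀
    simp only [map_zero, le_zero_iff] at this
    exact hj₀0 ((Valuation.zero_iff _).1 this)
  have hden : ∀ j : K, ∃ s : D, s ∉ P ∧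
      (j ∈ t → algebraMap D K s / x * j ∈ (1 : FractionalIdeal D⁰ K)) := by
    intro j
    by_cases hj : j ∈ t
    · have hV : j / x ∈ V := by
        rw [← V.valuation_le_one_iff, map_div₀]
        exact div_le_one_of_le₀ (hmax j hj) zero_le
      obtain ⟨a, s, hs, e⟩ := (h.2 _).1 hV
      refine ⟨s, hs, fun _ => ?_⟩
      have h2 : algebraMap D K s ≠ 0 := ne_zero_of_notMem hs
      have : algebraMap D K s / x * j = algebraMap D K a := by
        rw [div_mul_eq_mul_div, mul_div_assoc, e]
        field_simp
      rw [this]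
      exact algebraMap_mem_one a
    · exact ⟨1, h.1.one_notMem, fun h => absurd h hj⟩
  choose s hs hsm using hden
  refine ⟨x, htJ x hx, hx0, ∏ j ∈ t, s j, ?_, ?_⟩
  · have := h.1
    rw [Ideal.IsPrime.prod_mem_iff]
    rintro ⟨j, -, hj⟩
    exact hs j hj
  · intro j hj
    rw [← FractionalIdeal.mem_coe, ← ht] at hj
    induction hj using Submodule.span_induction with
    | mem j hj =>
      obtain ⟨c, hc⟩ := Finset.dvd_prod_of_mem s hj
      rw [hc, map_mul, mul_comm (algebraMap D K (s j)), mul_div_assoc, mul_assoc,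
        ← Algebra.smul_def]
      exact Submodule.smul_mem (1 : FractionalIdeal D⁰ K).val _ (hsm j hj)
    | zero =>
      rw [mul_zero]
      exact FractionalIdeal.zero_mem _
    | add y z _ _ hy hz =>
      rw [mul_add]
      exact Submodule.add_mem (1 : FractionalIdeal D⁰ K).val hy hz
    | smul c y _ hy =>
      rw [mul_smul_comm]
      exact Submodule.smul_mem (1 : FractionalIdeal D⁰ K).val c hy

/-- For finitely generated J ≤ P, some x in J and s outside P satisfy (s/x)J ⊆ D. Hence sy lies in
xD ⊆ P for every y in J_v, and y lies in P. -/
theorem isProperTIdeal (h : IsLocalizationAt V P) (hP : P ≠ ⊥) : IsProperTIdeal K P := by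
  refine ⟨h.1.ne_top, FractionalIdeal.coeIdeal_ne_zero.2 hP, le_antisymm ?_ (le_tClosure _)⟩
  rintro y ⟨J, hf, hJP, hy⟩
  rcases eq_or_ne J 0 with rfl | hJ
  · have : y = 0 := by
      rwa [vClosure, FractionalIdeal.inv_zero', FractionalIdeal.inv_zero',
        FractionalIdeal.mem_zero_iff] at hy
    rw [this]
    exact FractionalIdeal.zero_mem _
  · obtain ⟨d, rfl⟩ := (FractionalIdeal.mem_one_iff D⁰).1
      (vClosure_le_one (hJP.trans FractionalIdeal.coeIdeal_le_one) hy)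
    obtain ⟨x, hx, hx0, s, hs, hsx⟩ := h.exists_div_mem_inv hJ hf
    obtain ⟨p, hp, rfl⟩ := (FractionalIdeal.mem_coeIdeal _).1 (hJP hx)
    obtain ⟨c, hc⟩ := (FractionalIdeal.mem_one_iff D⁰).1 ((mem_vClosure hJ).1 hy _ hsx)
    have : d * s = c * p := by
      apply IsFractionRing.injective D K
      rw [map_mul, map_mul, hc]
      field_simp
    refine algebraMap_mem_coeIdeal.2 ((h.1.mem_or_mem (x := d) (y := s) ?_).resolve_right hs)
    rw [this]
    exact P.mul_mem_left _ hp

theorem ringKrullDim_eq (h : IsLocalizationAt V P) : ringKrullDim V = P.height := by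
  have := h.1
  let : Algebra D V := ((algebraMap D K).codRestrict V h.algebraMap_mem).toAlgebra
  have hc : ∀ d : D, ((algebraMap D V d : V) : K) = algebraMap D K d := fun _ => rfl
  have : IsLocalization.AtPrime V P := by
    refine ⟨⟨?_, ?_, ?_⟩⟩
    · rintro ⟨s, hs⟩
      have hs' : s ∉ P := hs
      have h0 : algebraMap D K s ≠ 0 := ne_zero_of_notMem hs'
      refine IsUnit.of_mul_eq_one ⟨(algebraMap D K s)⁻¹, (h.2 _).2 ⟨1, s, hs', by simp⟩⟩ ?_
      apply Subtype.ext
      exact mul_inv_cancel₀ h0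
    · rintro ⟨x, hx⟩
      obtain ⟨a, s, hs, e⟩ := (h.2 x).1 hx
      have h0 : algebraMap D K s ≠ 0 := ne_zero_of_notMem hs
      refine ⟨⟨a, ⟨s, hs⟩⟩, Subtype.ext ?_⟩
      change x * algebraMap D K s = algebraMap D K a
      rw [e, div_mul_cancel₀ _ h0]
    · intro x y hxy
      have : algebraMap D K x = algebraMap D K y := congrArg Subtype.val hxy
      exact ⟨1, by rw [IsFractionRing.injective D K this]⟩
  exact IsLocalization.AtPrime.ringKrullDim_eq_height P V

end IsLocalizationAt

end Essential

/-! ### Consequences of local finiteness. -/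

section LocallyFinite

variable {D : Type*} [CommRing D] [IsDomain D] {K : Type*} [Field K] [Algebra D K]
  [IsFractionRing D K] {S : Set (ValuationSubring K)}

theorem IsLocallyFiniteIntersection.mem_one_iff (hS : IsLocallyFiniteIntersection D S) {x : K} :
    x ∈ (1 : FractionalIdeal D⁰ K) ↔ ∀ V ∈ S, x ∈ V := by
  rw [← hS.1 x, FractionalIdeal.mem_one_iff]
  rfl

/-- In a locally finite intersection, an ideal contained in no center has `t`-closure `D`. -/
theorem IsLocallyFiniteIntersection.tClosure_eq_one (hS : IsLocallyFiniteIntersection D S)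
    {I : Ideal D} (hI : I ≠ ⊥) (h : ∀ V ∈ S, ∃ d ∈ I, ¬ V.valuation (algebraMap D K d) < 1) :
    tClosure (I : FractionalIdeal D⁰ K) = 1 := by
  refine le_antisymm
    ((tClosure_le_vClosure _).trans (vClosure_le_one FractionalIdeal.coeIdeal_le_one)) ?_
  obtain ⟨a, ha, ha0⟩ := Submodule.exists_mem_ne_zero_of_ne_bot hI
  have hb : ∀ V : ValuationSubring K, ∃ d ∈ I, V ∈ S → ¬ V.valuation (algebraMap D K d) < 1 := by
    intro V
    by_cases hV : V ∈ S
    · obtain ⟨d, hd, hd'⟩ := h V hV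
      exact ⟨d, hd, fun _ => hd'⟩
    · exact ⟨0, I.zero_mem, fun h => absurd h hV⟩
  choose b hbI hb using hb
  -- Only finitely many members of S have a as a nonunit; for each of them F gains an element of I
  -- that is a unit there.
  set F : Set D := insert a (b '' {V ∈ S | V.valuation (algebraMap D K a) < 1}) with hF
  have hFfin : F.Finite := ((hS.2 a ha0).image b).insert a
  have hFI : F ⊆ I := by
    rintro x (rfl | ⟨V, -, rfl⟩)
    · exact ha
    · exact hbI V
  have hFV : ∀ V ∈ S, ∃ d ∈ F, ¬ V.valuation (algebraMap D K d) < 1 := by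
    intro V hV
    by_cases hVa : V.valuation (algebraMap D K a) < 1
    · exact ⟨b V, Or.inr ⟨V, ⟨hV, hVa⟩, rfl⟩, hb V hV⟩
    · exact ⟨a, Or.inl rfl, hVa⟩
  have hJ : ((Ideal.span F : Ideal D) : FractionalIdeal D⁰ K) ≠ 0 :=
    FractionalIdeal.coeIdeal_ne_zero.2 fun h0 =>
      ha0 (Ideal.span_eq_bot.1 h0 a (Or.inl rfl))
  have h1 : (1 : K) ∈ tClosure (I : FractionalIdeal D⁰ K) := by
    refine ⟨(Ideal.span F : Ideal D), ?_, ?_, (mem_vClosure hJ).2 fun y hy => ?_⟩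
    · exact (FractionalIdeal.coeIdeal_fg D⁰ (IsFractionRing.injective D K) _).2
        (Submodule.fg_span hFfin)
    · exact (FractionalIdeal.coeIdeal_le_coeIdeal K).2 (Ideal.span_le.2 hFI)
    · rw [one_mul, hS.mem_one_iff]
      intro V hV
      obtain ⟨d, hd, hdV⟩ := hFV V hV
      have h2 := hS.mem_one_iff.1
        (hy _ (algebraMap_mem_coeIdeal.2 (Ideal.subset_span hd))) V hV
      rw [← V.valuation_le_one_iff, map_mul] at h2
      rw [← V.valuation_le_one_iff]
      calc V.valuation y = V.valuation y * 1 := (mul_one _).symm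
        _ ≤ V.valuation y * V.valuation (algebraMap D K d) := by
          gcongr
          exact not_lt.1 hdV
        _ ≤ 1 := h2
  rintro x hx
  obtain ⟨d, rfl⟩ := (FractionalIdeal.mem_one_iff D⁰).1 hx
  have := Submodule.smul_mem (tClosure (I : FractionalIdeal D⁰ K)).val d h1
  rwa [Algebra.smul_def, mul_one] at this

end LocallyFinite

/-! ### Maximal t-ideals and rigid ideals in rings of Krull type. -/

section Krull

variable {D : Type*} [CommRing D] [IsDomain D] {K : Type*} [Field K] [Algebra D K]
  [IsFractionRing D K] {S : Set (ValuationSubring K)}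

/-- V determines its center as the set of elements of value below one. -/
theorem IsLocallyFiniteIntersection.finite_centers (hS : IsLocallyFiniteIntersection D S)
    {a : D} (ha : a ≠ 0) : {P : Ideal D | a ∈ P ∧ ∃ V ∈ S, IsLocalizationAt V P}.Finite := by
  refine Set.Finite.of_finite_image (f := fun P : Ideal D => (P : Set D)) ?_
    SetLike.coe_injective.injOn
  refine ((hS.2 a ha).image fun V => {d : D | V.valuation (algebraMap D K d) < 1}).subset ?_
  rintro _ ⟨P, ⟨haP, V, hV, hVP⟩, rfl⟩
  refine ⟨V, ⟨hV, hVP.valuation_lt_one_iff.2 haP⟩, ?_⟩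
  ext d
  exact hVP.valuation_lt_one_iff

theorem tClosure_eq_one_of_not_le_center (hE : ∀ V ∈ S, IsEssentialValuationRing D V)
    (hS : IsLocallyFiniteIntersection D S) {I : Ideal D} (hI : I ≠ ⊥)
    (h : ∀ V ∈ S, ∀ P : Ideal D, IsLocalizationAt V P → ¬ I ≤ P) :
    tClosure (I : FractionalIdeal D⁰ K) = 1 := by
  refine hS.tClosure_eq_one hI fun V hV => ?_
  obtain ⟨P, hP⟩ := hE V hV
  obtain ⟨d, hd, hdP⟩ := SetLike.not_le_iff_exists.1 (h V hV P hP)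
  exact ⟨d, hd, fun hlt => hdP ((IsLocalizationAt.valuation_lt_one_iff hP).1 hlt)⟩

theorem IsProperTIdeal.ne_bot {I : Ideal D} (hI : IsProperTIdeal K I) : I ≠ ⊥ :=
  FractionalIdeal.coeIdeal_ne_zero.1 hI.2.1

theorem IsProperTIdeal.exists_le_center (hE : ∀ V ∈ S, IsEssentialValuationRing D V)
    (hS : IsLocallyFiniteIntersection D S) {I : Ideal D} (hI : IsProperTIdeal K I) :
    ∃ P : Ideal D, I ≤ P ∧ ∃ V ∈ S, IsLocalizationAt V P := by
  by_contra! h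
  have h1 := tClosure_eq_one_of_not_le_center hE hS hI.ne_bot fun V hV P hP hIP => h P hIP V hV hP
  rw [hI.2.2, FractionalIdeal.coeIdeal_eq_one] at h1
  exact hI.1 (h1.trans Ideal.one_eq_top)

/-- Zorn's lemma is not needed: only finitely many centers contain a given nonzero element of I, and
a maximal one among them is a maximal t-ideal. -/
theorem IsProperTIdeal.exists_le_maximal (hE : ∀ V ∈ S, IsEssentialValuationRing D V)
    (hS : IsLocallyFiniteIntersection D S) {I : Ideal D} (hI : IsProperTIdeal K I) :
    ∃ M : Ideal D, IsMaximalTIdeal K M ∧ I ≤ M := by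
  obtain ⟨a, ha, ha0⟩ := Submodule.exists_mem_ne_zero_of_ne_bot hI.ne_bot
  obtain ⟨P, hIP, hP⟩ := hI.exists_le_center hE hS
  obtain ⟨M, hPM, ⟨haM, V, hV, hVM⟩, hmax⟩ :=
    (hS.finite_centers ha0).exists_le_maximal (a := P) ⟨hIP ha, hP⟩
  refine ⟨M, ⟨hVM.isProperTIdeal fun h0 => ha0 (by simpa [h0] using haM), fun N hN hMN => ?_⟩,
    hIP.trans hPM⟩
  obtain ⟨Q, hNQ, hQ⟩ := hN.exists_le_center hE hS
  exact hNQ.trans (hmax ⟨hNQ (hMN haM), hQ⟩ (hMN.trans hNQ))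

theorem IsMaximalTIdeal.exists_isLocalizationAt (hE : ∀ V ∈ S, IsEssentialValuationRing D V)
    (hS : IsLocallyFiniteIntersection D S) {M : Ideal D} (hM : IsMaximalTIdeal K M) :
    ∃ V ∈ S, IsLocalizationAt V M := by
  obtain ⟨P, hMP, V, hV, hVP⟩ := hM.1.exists_le_center hE hS
  have hP : P ≠ ⊥ := fun h => hM.1.ne_bot (le_bot_iff.1 (h ▸ hMP))
  rw [(hM.2 (hVP.isProperTIdeal hP) hMP).antisymm hMP] at hVP
  exact ⟨V, hV, hVP⟩

theorem IsLocallyFiniteIntersection.finite_maximalTIdeals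
    (hE : ∀ V ∈ S, IsEssentialValuationRing D V) (hS : IsLocallyFiniteIntersection D S)
    {a : D} (ha : a ≠ 0) : {M : Ideal D | IsMaximalTIdeal K M ∧ a ∈ M}.Finite :=
  (hS.finite_centers ha).subset fun _ hM => ⟨hM.2, hM.1.exists_isLocalizationAt hE hS⟩

/-- A ring of Krull type is the intersection of its localizations at maximal `t`-ideals. -/
theorem mem_one_of_forall_maximalTIdeal (hE : ∀ V ∈ S, IsEssentialValuationRing D V)
    (hS : IsLocallyFiniteIntersection D S) {x : K}
    (h : ∀ M : Ideal D, IsMaximalTIdeal K M → ∀ V ∈ S, IsLocalizationAt V M → x ∈ V) :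
    x ∈ (1 : FractionalIdeal D⁰ K) := by
  rw [hS.mem_one_iff]
  intro V hV
  obtain ⟨P, hP⟩ := hE V hV
  have hP : IsLocalizationAt V P := hP
  -- A zero center means V = K, which imposes no condition on x.
  rcases eq_or_ne P ⊥ with rfl | hP0
  · obtain ⟨a, s, hs, e⟩ := IsFractionRing.div_surjective (A := D) x
    exact (hP.2 x).2 ⟨a, s, by simpa using nonZeroDivisors.ne_zero hs, e.symm⟩
  · obtain ⟨M, hM, hPM⟩ := (hP.isProperTIdeal hP0).exists_le_maximal hE hS
    obtain ⟨W, hW, hWM⟩ := hM.exists_isLocalizationAt hE hS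
    exact hP.le_of_le hWM hPM (h M hM W hW hWM)

/-- In a ring of Krull type, every `v`-ideal of finite type is `t`-invertible. -/
theorem IsFiniteTypeVIdeal.isTInvertible (hE : ∀ V ∈ S, IsEssentialValuationRing D V)
    (hS : IsLocallyFiniteIntersection D S) {I : FractionalIdeal D⁰ K}
    (hI : IsFiniteTypeVIdeal I) : IsTInvertible I := by
  refine ⟨hI.isTIdeal.1, ?_⟩
  obtain ⟨A, hA, hf, rfl⟩ := hI
  have hA' := vClosure_ne_zero hA
  obtain ⟨C, hC⟩ := FractionalIdeal.le_one_iff_exists_coeIdeal.1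
    (show vClosure A * (vClosure A)⁻¹ ≤ 1 from FractionalIdeal.mul_one_div_le_one)
  have hC0 : C ≠ ⊥ := by
    rw [← FractionalIdeal.coeIdeal_ne_zero (K := K), hC]
    exact ((FractionalIdeal.zero_le _).trans_lt (FractionalIdeal.bot_lt_mul_inv hA')).ne'
  rw [← hC]
  refine tClosure_eq_one_of_not_le_center hE hS hC0 fun V hV P hP hCP => ?_
  obtain ⟨x, hx, hx0, s, hs, hsx⟩ := hP.exists_div_mem_inv hA hf
  -- The factorization s = x · (s/x) puts s in the product of A_v and its inverse.
  refine hs (hCP (algebraMap_mem_coeIdeal (K := K).1 ?_))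
  rw [hC, ← mul_div_cancel₀ (algebraMap D K s) hx0]
  refine FractionalIdeal.mul_mem_mul (le_vClosure A hx)
    ((FractionalIdeal.mem_inv_iff hA').2 fun y hy => ?_)
  rw [mul_comm]
  exact (mem_vClosure hA).1 hy _ hsx

/-- Every nonzero element of a maximal `t`-ideal lies in a rigid ideal contained in it. -/
theorem IsMaximalTIdeal.exists_isRigidIdeal (hE : ∀ V ∈ S, IsEssentialValuationRing D V)
    (hS : IsLocallyFiniteIntersection D S) {M : Ideal D} (hM : IsMaximalTIdeal K M) {a : D}
    (ha : a ∈ M) (ha0 : a ≠ 0) : ∃ J : Ideal D, IsRigidIdeal K J ∧ a ∈ J ∧ J ≤ M := by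
  have hb : ∀ N : Ideal D, ∃ b ∈ M, IsMaximalTIdeal K N → N ≠ M → b ∉ N := by
    intro N
    by_cases hN : IsMaximalTIdeal K N ∧ N ≠ M
    · obtain ⟨b, hb, hbN⟩ := SetLike.not_le_iff_exists.1
        fun hMN : M ≤ N => hN.2 ((hM.2 hN.1.1 hMN).antisymm hMN)
      exact ⟨b, hb, fun _ _ => hbN⟩
    · exact ⟨0, M.zero_mem, fun h1 h2 => absurd ⟨h1, h2⟩ hN⟩
  choose b hbM hb using hb
  -- For each of the finitely many maximal t-ideals N ≠ M containing a, F gains an element of M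
  -- outside N.
  set F : Set D := insert a (b '' {N : Ideal D | IsMaximalTIdeal K N ∧ a ∈ N})
  have hFfin : F.Finite := ((hS.finite_maximalTIdeals hE ha0).image b).insert a
  have hFM : F ⊆ M := by
    rintro x (rfl | ⟨N, -, rfl⟩)
    · exact ha
    · exact hbM N
  have hA : ((Ideal.span F : Ideal D) : FractionalIdeal D⁰ K) ≠ 0 :=
    FractionalIdeal.coeIdeal_ne_zero.2 fun h0 =>
      ha0 (Ideal.span_eq_bot.1 h0 a (Or.inl rfl))
  have hAf : (((Ideal.span F : Ideal D) : FractionalIdeal D⁰ K) : Submodule D K).FG :=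
    (FractionalIdeal.coeIdeal_fg D⁰ (IsFractionRing.injective D K) _).2 (Submodule.fg_span hFfin)
  obtain ⟨J, hJ⟩ := FractionalIdeal.le_one_iff_exists_coeIdeal.1
    (vClosure_le_one (FractionalIdeal.coeIdeal_le_one (I := Ideal.span F) (P := K)))
  have hFJ : F ⊆ J := fun x hx => algebraMap_mem_coeIdeal (K := K).1 (by
    rw [hJ]
    exact le_vClosure _ (algebraMap_mem_coeIdeal.2 (Ideal.subset_span hx)))
  have hJM : J ≤ M := by
    rw [← FractionalIdeal.coeIdeal_le_coeIdeal K, hJ]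
    exact hM.1.2.vClosure_le hAf ((FractionalIdeal.coeIdeal_le_coeIdeal K).2 (Ideal.span_le.2 hFM))
  refine ⟨J, ⟨⟨_, hA, hAf, hJ⟩, M, ⟨hM, hJM⟩, ?_⟩, hFJ (Or.inl rfl), hJM⟩
  rintro N ⟨hN, hJN⟩
  by_contra hNM
  exact hb N hN hNM (hJN (hFJ (Or.inr ⟨N, ⟨hN, hJN (hFJ (Or.inl rfl))⟩, rfl⟩)))

/-- A nonzero prime ideal inside a maximal `t`-ideal `M` lies in every `(J^n)_v` when `J ⊆ M` is
rigid and not contained in the prime. -/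
theorem IsRigidIdeal.mem_vClosure_pow (hE : ∀ V ∈ S, IsEssentialValuationRing D V)
    (hS : IsLocallyFiniteIntersection D S) {J M Q : Ideal D} (hJ : IsRigidIdeal K J)
    (hM : IsMaximalTIdeal K M) (hJM : J ≤ M) (hQ : Q.IsPrime) (hQM : Q ≤ M) {a q : D}
    (haJ : a ∈ J) (haQ : a ∉ Q) (hq : q ∈ Q) (n : ℕ) :
    algebraMap D K q ∈ vClosure ((J : FractionalIdeal D⁰ K) ^ n) := by
  have hJ0 : (J : FractionalIdeal D⁰ K) ^ n ≠ 0 := by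
    rw [← FractionalIdeal.coeIdeal_pow, FractionalIdeal.coeIdeal_ne_zero]
    exact pow_ne_zero n (FractionalIdeal.coeIdeal_ne_zero.1 hJ.1.isTIdeal.1)
  refine (mem_vClosure hJ0).2 fun y hy => mem_one_of_forall_maximalTIdeal hE hS
    fun N hN V hV hVN => ?_
  have hyV : ∀ j ∈ J, y * algebraMap D K (j ^ n) ∈ V := fun j hj =>
    hS.mem_one_iff.1 (hy _ (by
      rw [← FractionalIdeal.coeIdeal_pow, algebraMap_mem_coeIdeal]
      exact Ideal.pow_mem_pow hj n)) V hV
  by_cases hNM : N = M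
  · subst hNM
    -- Otherwise the inverse lies in V = D_M, giving a^n s in Q with neither factor in Q.
    have hqV : algebraMap D K q / algebraMap D K (a ^ n) ∈ V := by
      have han : a ^ n ∉ Q := fun h => haQ (hQ.mem_of_pow_mem n h)
      rcases eq_or_ne q 0 with rfl | hq0
      · simp
      rcases V.mem_or_inv_mem (algebraMap D K q / algebraMap D K (a ^ n)) with h | h
      · exact h
      · exfalso
        obtain ⟨c, s, hs, e⟩ := (hVN.2 _).1 h
        have h1 := algebraMap_ne_zero (K := K) hq0
        have h2 : algebraMap D K s ≠ 0 := IsLocalizationAt.ne_zero_of_notMem hs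
        have h3 : a ^ n * s = c * q := by
          apply IsFractionRing.injective D K
          rw [inv_div, div_eq_div_iff h1 h2] at e
          rw [map_mul, map_mul, e]
        refine (hQ.mem_or_mem (x := a ^ n) (y := s) ?_).elim han fun h => hs (hQM h)
        rw [h3]
        exact Q.mul_mem_left _ hq
    have h4 : algebraMap D K (a ^ n) ≠ 0 :=
      algebraMap_ne_zero (pow_ne_zero n fun h => haQ (h ▸ Q.zero_mem))
    have := V.mul_mem _ _ hqV (hyV a haJ)
    convert this using 1
    field_simp
  · have hJN : ¬ J ≤ N := fun h => hNM (hJ.2.unique ⟨hN, h⟩ ⟨hM, hJM⟩)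
    obtain ⟨j, hj, hjN⟩ := SetLike.not_le_iff_exists.1 hJN
    have hjn : j ^ n ∉ N := fun h => hjN (hVN.1.mem_of_pow_mem n h)
    have h4 : algebraMap D K (j ^ n) ≠ 0 := IsLocalizationAt.ne_zero_of_notMem hjn
    have := V.mul_mem _ _ (V.mul_mem _ _ (hVN.algebraMap_mem q) (hyV j hj))
      ((hVN.inv_mem_iff fun h : j ^ n = 0 => hjn (h ▸ N.zero_mem)).2 hjn)
    convert this using 1
    field_simp

end Krull

/-! ### Complete integral closure. -/

section CompletelyIntegrallyClosed

variable {D : Type*} [CommRing D] [IsDomain D] {K : Type*} [Field K] [Algebra D K]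
  [IsFractionRing D K]

theorem hasZeroVPowerIntersection_iff {I : Ideal D} : HasZeroVPowerIntersection K I ↔
    ∀ x : K, (∀ n : ℕ, 1 ≤ n → x ∈ vClosure ((I : FractionalIdeal D⁰ K) ^ n)) → x = 0 := by
  unfold HasZeroVPowerIntersection
  rw [Set.eq_singleton_iff_unique_mem]
  simp only [Set.mem_iInter, SetLike.mem_coe]
  exact ⟨fun h => h.2, fun h => ⟨fun n _ => FractionalIdeal.zero_mem _, h⟩⟩

theorem IsCompletelyIntegrallyClosed.hasZeroVPowerIntersection
    (h : IsCompletelyIntegrallyClosed D K) {I : Ideal D} (hI : IsProperTIdeal K I)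
    (hinv : IsTInvertible (I : FractionalIdeal D⁰ K)) : HasZeroVPowerIntersection K I := by
  rw [hasZeroVPowerIntersection_iff]
  intro x hx
  by_contra hx0
  have hI0 : ∀ n : ℕ, (I : FractionalIdeal D⁰ K) ^ n ≠ 0 := fun n => by
    rw [← FractionalIdeal.coeIdeal_pow, FractionalIdeal.coeIdeal_ne_zero]
    exact pow_ne_zero n hI.ne_bot
  obtain ⟨d, s, hs, e⟩ := IsFractionRing.div_surjective (A := D) x
  have hs0 : algebraMap D K s ≠ 0 := algebraMap_ne_zero (nonZeroDivisors.ne_zero hs)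
  have hd0 : d ≠ 0 := by
    rintro rfl
    exact hx0 (by simp [← e])
  have hle : (I : FractionalIdeal D⁰ K)⁻¹ ≤ 1 := by
    intro y hy
    refine (FractionalIdeal.mem_one_iff D⁰).2 (h y ⟨d, mem_nonZeroDivisors_of_ne_zero hd0, ?_⟩)
    -- The hypothesis covers positive powers only, while almost integrality also tests exponent
    -- zero.
    rintro (_ | n)
    · exact ⟨d, by simp [Algebra.smul_def]⟩
    · have hyn : ∀ m : ℕ, ∀ i ∈ (I : FractionalIdeal D⁰ K) ^ m,
          y ^ m * i ∈ (1 : FractionalIdeal D⁰ K) := by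
        intro m i hi
        have h1 : (I : FractionalIdeal D⁰ K)⁻¹ ^ m * (I : FractionalIdeal D⁰ K) ^ m ≤ 1 := by
          rw [← mul_pow]
          refine pow_le_one' ?_ m
          rw [mul_comm]
          exact FractionalIdeal.mul_one_div_le_one
        refine h1 (FractionalIdeal.mul_mem_mul ?_ hi)
        rw [← FractionalIdeal.mem_coe, FractionalIdeal.coe_pow]
        exact Submodule.pow_mem_pow _ hy m
      have h2 := (mem_vClosure (hI0 (n + 1))).1 (hx (n + 1) n.succ_pos) _ (hyn (n + 1))
      have h3 := Submodule.smul_mem (1 : FractionalIdeal D⁰ K).val s h2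
      obtain ⟨c, hc⟩ := (FractionalIdeal.mem_one_iff D⁰).1 h3
      refine ⟨c, hc.trans ?_⟩
      rw [Algebra.smul_def, Algebra.smul_def, ← e]
      field_simp
  have hle' : (I : FractionalIdeal D⁰ K) * (I : FractionalIdeal D⁰ K)⁻¹ ≤ I := by
    calc (I : FractionalIdeal D⁰ K) * (I : FractionalIdeal D⁰ K)⁻¹ ≤ I * 1 := by gcongr
      _ = I := mul_one _
  have h1 := tClosure_mono hle'
  rw [hinv.2, hI.2.2] at h1
  exact hI.1 ((FractionalIdeal.coeIdeal_eq_one.1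
    (FractionalIdeal.coeIdeal_le_one.antisymm h1)).trans Ideal.one_eq_top)

/-- Rank-one valuation rings are completely integrally closed. -/
theorem mem_of_forall_mul_pow_mem {V : ValuationSubring K} (hV : ringKrullDim V = 1)
    {r x : K} (hr : r ≠ 0) (h : ∀ n : ℕ, r * x ^ n ∈ V) : x ∈ V := by
  by_contra hx
  have hx0 : x ≠ 0 := fun h0 => hx (h0 ▸ V.zero_mem)
  have hy : x⁻¹ ∈ V := (V.mem_or_inv_mem x).resolve_left hx
  have hrV : r ∈ V := by simpa using h 0
  have : Ring.KrullDimLE 1 V := Ring.krullDimLE_iff.2 (by rw [hV]; rfl)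
  set y : V := ⟨x⁻¹, hy⟩
  have hyu : ¬ IsUnit y := by
    intro hu
    obtain ⟨z, hz⟩ := hu.exists_right_inv
    have hz' : x⁻¹ * (z : K) = 1 := congrArg Subtype.val hz
    have : (z : K) = x := by
      field_simp at hz'
      exact hz'
    exact hx (this ▸ z.2)
  -- In dimension one, every prime containing r is maximal, so the nonunit y = x⁻¹ has a power y^n =
  -- rc; then x = (r x^(n+1)) c lies in V.
  have hrad : y ∈ (Ideal.span {(⟨r, hrV⟩ : V)}).radical := by
    rw [Ideal.radical_eq_sInf, Ideal.mem_sInf]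
    rintro P ⟨hrP, hP⟩
    have hP0 : P ≠ ⊥ := by
      rintro rfl
      have := hrP (Ideal.mem_span_singleton_self _)
      exact hr (congrArg Subtype.val (Ideal.mem_bot.1 this))
    have hPm := hP.isMaximal_of_ne_bot hP0
    rw [IsLocalRing.eq_maximalIdeal hPm]
    exact (IsLocalRing.mem_maximalIdeal _).2 hyu
  obtain ⟨n, hn⟩ := hrad
  obtain ⟨c, hc⟩ := Ideal.mem_span_singleton.1 hn
  have hc' : x⁻¹ ^ n = r * (c : K) := congrArg Subtype.val hc
  refine hx ?_
  have := V.mul_mem _ _ (h (n + 1)) c.2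
  convert this using 1
  rw [mul_right_comm, ← hc', inv_pow, pow_succ, ← mul_assoc, inv_mul_cancel₀ (pow_ne_zero n hx0),
    one_mul]

theorem IsLocallyFiniteIntersectionOfRankOne.isCompletelyIntegrallyClosed
    (h : IsLocallyFiniteIntersectionOfRankOne D K) : IsCompletelyIntegrallyClosed D K := by
  obtain ⟨S, hdim, hS⟩ := h
  rintro x ⟨r, hr, hx⟩
  refine (hS.1 x).2 fun V hV => mem_of_forall_mul_pow_mem (hdim V hV)
    (algebraMap_ne_zero (nonZeroDivisors.ne_zero hr)) fun n => ?_
  rw [← Algebra.smul_def]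
  exact (hS.1 _).1 (hx n) V hV

end CompletelyIntegrallyClosed

/-! ### Height one and rank one. -/

section Height

variable {D : Type*} [CommRing D] [IsDomain D] {K : Type*} [Field K] [Algebra D K]
  [IsFractionRing D K] {S : Set (ValuationSubring K)}

theorem height_eq_one_of_forall_prime {M : Ideal D} (hM : M.IsPrime) (hM0 : M ≠ ⊥)
    (h : ∀ Q : Ideal D, Q.IsPrime → Q < M → Q = ⊥) : M.height = 1 := by
  refine le_antisymm (Ideal.height_le_iff (n := 1).2 fun Q hQ hlt => ?_) ?_
  · rw [h Q hQ hlt, Ideal.height_bot]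
    exact zero_lt_one
  · rw [Order.one_le_iff_ne_zero, Ne, Ideal.height_eq_zero_iff_eq_bot]
    exact hM0

theorem IsMaximalTIdeal.height_eq_one (hE : ∀ V ∈ S, IsEssentialValuationRing D V)
    (hS : IsLocallyFiniteIntersection D S)
    (h : ∀ J : Ideal D, IsRigidIdeal K J → HasZeroVPowerIntersection K J)
    {M : Ideal D} (hM : IsMaximalTIdeal K M) : M.height = 1 := by
  obtain ⟨V, -, hVM⟩ := hM.exists_isLocalizationAt hE hS
  refine height_eq_one_of_forall_prime hVM.1 hM.1.ne_bot fun Q hQ hlt => ?_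
  by_contra hQ0
  obtain ⟨q, hq, hq0⟩ := Submodule.exists_mem_ne_zero_of_ne_bot hQ0
  obtain ⟨a, haM, haQ⟩ := SetLike.exists_of_lt hlt
  obtain ⟨J, hJ, haJ, hJM⟩ :=
    hM.exists_isRigidIdeal hE hS haM fun h0 => haQ (h0 ▸ Q.zero_mem)
  exact algebraMap_ne_zero (K := K) hq0 (hasZeroVPowerIntersection_iff.1 (h J hJ) _ fun n _ =>
    hJ.mem_vClosure_pow hE hS hM hJM hQ hlt.le haJ haQ hq n)

theorem isLocallyFiniteIntersectionOfRankOne_of_height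
    (hE : ∀ V ∈ S, IsEssentialValuationRing D V) (hS : IsLocallyFiniteIntersection D S)
    (h : ∀ M : Ideal D, IsMaximalTIdeal K M → M.height = 1) :
    IsLocallyFiniteIntersectionOfRankOne D K := by
  -- Only the members centered on maximal t-ideals are kept: they still cut out D, and others, such
  -- as K itself, may fail to have rank one.
  refine ⟨{V ∈ S | ∃ M : Ideal D, IsMaximalTIdeal K M ∧ IsLocalizationAt V M}, ?_, ?_, ?_⟩
  · rintro V ⟨-, M, hM, hVM⟩
    rw [hVM.ringKrullDim_eq, h M hM]
    rfl
  · intro x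
    refine ⟨fun hx V hV => (hS.1 x).1 hx V hV.1, fun hx => ?_⟩
    exact (FractionalIdeal.mem_one_iff D⁰).1 (mem_one_of_forall_maximalTIdeal hE hS
      fun M hM V hV hVM => hx V ⟨hV, M, hM, hVM⟩)
  · exact fun d hd => (hS.2 d hd).subset fun V hV => ⟨hV.1.1, hV.2⟩

end Height

end KrullType

theorem proposition3p1 (D : Type*) [CommRing D] [IsDomain D] (K : Type*) [Field K] [Algebra D K]
    [IsFractionRing D K] (hD : KrullType.IsRingOfKrullType D K) :
    List.TFAE
      [KrullType.IsCompletelyIntegrallyClosed D K,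
       ∀ I : Ideal D, KrullType.IsProperTIdeal K I →
         KrullType.IsTInvertible (I : FractionalIdeal D⁰ K) →
         KrullType.HasZeroVPowerIntersection K I,
       ∀ J : Ideal D, KrullType.IsRigidIdeal K J → KrullType.HasZeroVPowerIntersection K J,
       ∀ M : Ideal D, KrullType.IsMaximalTIdeal K M → M.height = 1,
       KrullType.IsLocallyFiniteIntersectionOfRankOne D K] := by
  obtain ⟨S, hE, hS⟩ := hD
  tfae_have 1 → 2 := fun h _ hI hinv => h.hasZeroVPowerIntersection hI hinv
  tfae_have 2 → 3 := fun h J hJ => by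
    obtain ⟨M, ⟨hM, hJM⟩, -⟩ := hJ.2
    exact h J ⟨fun hJ1 => hM.1.1 (top_le_iff.1 (hJ1 ▸ hJM)), hJ.1.isTIdeal⟩
      (hJ.1.isTInvertible hE hS)
  tfae_have 3 → 4 := fun h _ hM => hM.height_eq_one hE hS h
  tfae_have 4 → 5 := KrullType.isLocallyFiniteIntersectionOfRankOne_of_height hE hS
  tfae_have 5 → 1 := KrullType.IsLocallyFiniteIntersectionOfRankOne.isCompletelyIntegrallyClosed
  tfae_finish
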